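/- Let $\mathcal O$ be the ring of germs at $0\in\mathbb C$ of holomorphic functions of $t$, and let $\epsilon=t\frac{d}{dt}$. A differential operator $L=\sum_{k=0}^n a_k(t)\epsilon^k$ with $a_k\in\mathcal O$ is called *Fuchsian* (of order $n\ge 0$) if $a_n(0)\neq 0$; its *Euler part* is the polynomial $\mathcal E(L)=\sum_{k=0}^n a_k(0)\epsilon^k\in\mathbb C[\epsilon]$. Two Fuchsian operators $L,M$ of the same order are *$\mathcal F$-equivalent* if there are Fuchsian operators $H,K$ (of any orders, order zero included) such that $MH=KL$ and $\gcd(\mathcal E(H),\mathcal E(L))=1$. Let $L$ be a Fuchsian operator of order $n$ and let $N\ge 0$ be the largest non-negative integer that is a difference of two (possibly equal) roots of $\mathcal E(L)$ ($N=0$ if no two distinct roots differ by an integer, or if $n=0$). Then there are polynomials $r_1,\dots,r_n\in\mathbb C[t]$ with $r_i(0)=0$ and $\deg r_i\le N$, and an enumeration $\lambda_1,\dots,\lambda_n$ of the roots of $\mathcal E(L)$, each repeated according to its multiplicity, such that $L$ is $\mathcal F$-equivalent to the Fuchsian operator $$M=(\epsilon-\lambda_1+r_1(t))(\epsilon-\lambda_2+r_2(t))\cdots(\epsilon-\lambda_n+r_n(t)).$$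 -/

import Mathlib

noncomputable section

namespace Fuchs

open scoped PowerSeries

/-! ### Germs of holomorphic functions at the origin, identified with their Taylor series -/

/-- The power series `f` is the Taylor series at `0` of a function holomorphic near `0`. -/
def IsHolomorphic (f : ℂ⟦X⟧) : Prop :=
  ∃ F : ℂ → ℂ,
    HasFPowerSeriesAt F (FormalMultilinearSeries.ofScalars ℂ fun n => PowerSeries.coeff n f) 0

theorem isHolomorphic_iff (f : ℂ⟦X⟧) :
    IsHolomorphic f ↔ ∃ C : ℝ, ∃ R : ℝ, 0 < R ∧ ∀ n, ‖PowerSeries.coeff n f‖ ≤ C * R ^ n := by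
  constructor
  · rintro ⟨F, hF⟩
    obtain ⟨C, R, -, hR, h⟩ := FormalMultilinearSeries.le_mul_pow_of_radius_pos _ hF.radius_pos
    refine ⟨C, R, hR, fun n => ?_⟩
    simpa [FormalMultilinearSeries.ofScalars_norm] using h n
  · rintro ⟨C, R, hR, h⟩
    refine ⟨_, (FormalMultilinearSeries.hasFPowerSeriesOnBall _ ?_).hasFPowerSeriesAt⟩
    refine lt_of_lt_of_le ?_ (FormalMultilinearSeries.le_radius_of_bound _ C
      (r := R⁻¹.toNNReal) fun n => ?_)
    · simpa using hR
    · rw [FormalMultilinearSeries.ofScalars_norm, Real.coe_toNNReal _ (inv_pos.2 hR).le]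
      calc ‖PowerSeries.coeff n f‖ * R⁻¹ ^ n ≤ C * R ^ n * R⁻¹ ^ n := by
            gcongr
            exact h n
        _ = C := by
            rw [mul_assoc, ← mul_pow, mul_inv_cancel₀ hR.ne', one_pow, mul_one]

theorem IsHolomorphic.exists_bound {f : ℂ⟦X⟧} (hf : IsHolomorphic f) :
    ∃ C : ℝ, ∃ R : ℝ, 0 ≤ C ∧ 1 ≤ R ∧ ∀ n, ‖PowerSeries.coeff n f‖ ≤ C * R ^ n := by
  obtain ⟨C, R, hR, h⟩ := (isHolomorphic_iff f).1 hf
  have hC : 0 ≤ C := by simpa using (norm_nonneg _).trans (h 0)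
  refine ⟨C, max R 1, hC, le_max_right _ _, fun n => (h n).trans ?_⟩
  gcongr
  exact le_max_left _ _

theorem isHolomorphic_coe (p : Polynomial ℂ) : IsHolomorphic (p : ℂ⟦X⟧) := by
  refine (isHolomorphic_iff _).2 ⟨∑ i ∈ p.support, ‖p.coeff i‖, 1, one_pos, fun n => ?_⟩
  rw [Polynomial.coeff_coe, one_pow, mul_one]
  by_cases hn : n ∈ p.support
  · exact Finset.single_le_sum (f := fun i => ‖p.coeff i‖) (fun _ _ => norm_nonneg _) hn
  · rw [Polynomial.notMem_support_iff.1 hn, norm_zero]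
    positivity

theorem IsHolomorphic.add {f g : ℂ⟦X⟧} (hf : IsHolomorphic f) (hg : IsHolomorphic g) :
    IsHolomorphic (f + g) := by
  obtain ⟨F, hF⟩ := hf
  obtain ⟨G, hG⟩ := hg
  refine ⟨F + G, ?_⟩
  have h := hF.add hG
  rw [← FormalMultilinearSeries.ofScalars_add] at h
  exact h

theorem IsHolomorphic.mul {f g : ℂ⟦X⟧} (hf : IsHolomorphic f) (hg : IsHolomorphic g) :
    IsHolomorphic (f * g) := by
  obtain ⟨C, R, hC, hR, hf⟩ := hf.exists_bound
  obtain ⟨D, S, hD, hS, hg⟩ := hg.exists_bound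
  refine (isHolomorphic_iff _).2 ⟨C * D, 2 * (R * S), by positivity, fun n => ?_⟩
  rw [PowerSeries.coeff_mul]
  have key : ∀ p ∈ Finset.HasAntidiagonal.antidiagonal n,
      ‖PowerSeries.coeff p.1 f * PowerSeries.coeff p.2 g‖ ≤ C * D * (R * S) ^ n := by
    intro p hp
    have hp' := Finset.HasAntidiagonal.mem_antidiagonal.1 hp
    rw [norm_mul]
    calc ‖PowerSeries.coeff p.1 f‖ * ‖PowerSeries.coeff p.2 g‖
        ≤ (C * R ^ p.1) * (D * S ^ p.2) := by
          gcongr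
          · exact hf _
          · exact hg _
      _ ≤ (C * R ^ n) * (D * S ^ n) := by
          gcongr <;> first | assumption | omega
      _ = C * D * (R * S) ^ n := by rw [mul_pow]; ring
  refine (norm_sum_le_of_le _ key).trans ?_
  rw [Finset.sum_const, Finset.Nat.card_antidiagonal, nsmul_eq_mul, mul_pow 2]
  have h2 : ((n + 1 : ℕ) : ℝ) ≤ 2 ^ n := by exact_mod_cast Nat.lt_two_pow_self
  calc ((n + 1 : ℕ) : ℝ) * (C * D * (R * S) ^ n) ≤ 2 ^ n * (C * D * (R * S) ^ n) := by
        gcongr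
    _ = C * D * (2 ^ n * (R * S) ^ n) := by ring

/-- The ring of germs at the origin of holomorphic functions of one variable `t`. -/
def Hol : Subalgebra ℂ ℂ⟦X⟧ where
  carrier := {f | IsHolomorphic f}
  mul_mem' := IsHolomorphic.mul
  add_mem' := IsHolomorphic.add
  algebraMap_mem' c := by
    have h := isHolomorphic_coe (Polynomial.C c)
    rwa [Polynomial.coe_C] at h

theorem IsHolomorphic.euler {f : ℂ⟦X⟧} (hf : IsHolomorphic f) :
    IsHolomorphic (PowerSeries.X * PowerSeries.derivative ℂ f) := by
  obtain ⟨C, R, hC, hR, hf⟩ := hf.exists_bound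
  refine (isHolomorphic_iff _).2 ⟨C, 2 * R, by positivity, fun n => ?_⟩
  cases n with
  | zero => simpa using hC
  | succ n =>
    rw [PowerSeries.coeff_succ_X_mul, PowerSeries.coeff_derivative, norm_mul, mul_pow]
    have h1 : ‖((n : ℂ) + 1)‖ = ((n + 1 : ℕ) : ℝ) := by
      rw [← Nat.cast_succ, Complex.norm_natCast]
    have h2 : ((n + 1 : ℕ) : ℝ) ≤ 2 ^ (n + 1) := by
      exact_mod_cast (Nat.lt_two_pow_self (n := n + 1)).le
    rw [h1]
    calc ‖PowerSeries.coeff (n + 1) f‖ * ((n + 1 : ℕ) : ℝ)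
        ≤ (C * R ^ (n + 1)) * 2 ^ (n + 1) := by
          gcongr
          exact hf _
      _ = C * (2 ^ (n + 1) * R ^ (n + 1)) := by ring

/-- The Euler derivation `f ↦ t f'` of the ring of holomorphic germs. -/
def euler : Derivation ℂ Hol Hol where
  toFun f := ⟨PowerSeries.X * PowerSeries.derivative ℂ (f : ℂ⟦X⟧), f.2.euler⟩
  map_add' f g := by
    ext1
    simp [mul_add]
  map_smul' c f := by
    ext1
    simp
  map_one_eq_zero' := by
    ext1
    simp
  leibniz' f g := by
    ext1
    simp only [LinearMap.coe_mk, AddHom.coe_mk, smul_eq_mul, Subalgebra.coe_mul,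
      Subalgebra.coe_add, Derivation.leibniz]
    ring

/-- The value `f(0)` of a holomorphic germ. -/
def value : Hol →+* ℂ := (PowerSeries.constantCoeff (R := ℂ)).comp Hol.val.toRingHom

/-- A polynomial in `t`, as a holomorphic germ. -/
def ofPoly : Polynomial ℂ →+* Hol where
  toFun p := ⟨(p : ℂ⟦X⟧), isHolomorphic_coe p⟩
  map_one' := by
    ext1
    simp
  map_mul' p q := by
    ext1
    simp
  map_zero' := by
    ext1
    simp
  map_add' p q := by
    ext1
    simp

/-! ### Differential operators over a differential ring -/

section Operators

variable {A : Type*} [CommRing A] [Algebra ℂ A]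

/-- Differential operators in standard form: finite sums `∑ aₖ εᵏ`, with the coefficients `aₖ` to
the left of the powers of the symbol `ε`. As an additive group these are the polynomials in `ε`;
the product is defined below, and is determined by `ε a = a ε + δ a`. -/
def DiffOp (_δ : Derivation ℂ A A) : Type _ := Polynomial A

namespace DiffOp

variable {δ : Derivation ℂ A A}

instance : AddCommGroup (DiffOp δ) := inferInstanceAs (AddCommGroup (Polynomial A))

/-- The coefficients of an operator, collected as a polynomial in the (commuting) symbol `ε`. -/
def symbol : DiffOp δ ≃+ Polynomial A := AddEquiv.refl _

theorem symbol_injective : Function.Injective (symbol : DiffOp δ → Polynomial A) :=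
  symbol.injective

variable (δ) in
/-- Composition with `ε` on the left: `ε (∑ aₖ εᵏ) = ∑ (aₖ εᵏ⁺¹ + δ(aₖ) εᵏ)`. -/
def leftEps : AddMonoid.End (Polynomial A) where
  toFun p := Polynomial.X * p + p.sum fun k a => Polynomial.monomial k (δ a)
  map_zero' := by simp
  map_add' p q := by
    rw [Polynomial.sum_add_index p q _ (by simp) (by simp), mul_add]
    abel

theorem leftEps_monomial (k : ℕ) (a : A) :
    leftEps δ (Polynomial.monomial k a) =
      Polynomial.monomial (k + 1) a + Polynomial.monomial k (δ a) := by
  change Polynomial.X * Polynomial.monomial k a + Polynomial.sum _ _ = _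
  rw [Polynomial.X_mul_monomial, Polynomial.sum_monomial_index _ _ (by simp)]

/-- Composition with a coefficient `a` on the left. -/
def leftCoeff : A →+* AddMonoid.End (Polynomial A) :=
  Module.toAddMonoidEnd A (Polynomial A)

variable (δ) in
/-- Composition with `∑ aₖ εᵏ` on the left. -/
def leftMul : Polynomial A →+ AddMonoid.End (Polynomial A) where
  toFun p := p.sum fun k a => leftCoeff a * leftEps δ ^ k
  map_zero' := by simp
  map_add' p q := Polynomial.sum_add_index p q _ (by simp) (by simp [add_mul])

theorem leftMul_add_apply (p q s : Polynomial A) :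
    leftMul δ (p + q) s = leftMul δ p s + leftMul δ q s := by
  rw [map_add]
  rfl

theorem leftMul_zero_apply (s : Polynomial A) : leftMul δ 0 s = 0 := by
  rw [map_zero]
  rfl

set_option linter.unusedSectionVars false in
theorem leftCoeff_monomial (a : A) (k : ℕ) (b : A) :
    leftCoeff a (Polynomial.monomial k b) = Polynomial.monomial k (a * b) := by
  change a • Polynomial.monomial k b = _
  rw [Polynomial.smul_monomial, smul_eq_mul]

theorem leftMul_monomial (k : ℕ) (a : A) :
    leftMul δ (Polynomial.monomial k a) = leftCoeff a * leftEps δ ^ k := by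
  change (Polynomial.monomial k a).sum (fun j b => leftCoeff b * leftEps δ ^ j) = _
  rw [Polynomial.sum_monomial_index _ _ (by simp)]

theorem leftEps_mul_leftCoeff (a : A) :
    leftEps δ * leftCoeff a = leftCoeff a * leftEps δ + leftCoeff (δ a) := by
  apply DFunLike.ext
  intro p
  change leftEps δ (leftCoeff a p) =
    (leftCoeff a (leftEps δ p) + leftCoeff (δ a) p : Polynomial A)
  induction p using Polynomial.induction_on' with
  | add p q hp hq =>
    simp only [map_add, hp, hq]
    abel
  | monomial k b =>
    simp only [leftCoeff_monomial, leftEps_monomial, map_add, Derivation.leibniz, smul_eq_mul]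
    rw [add_assoc, mul_comm b (δ a)]

theorem leftMul_leftEps (p : Polynomial A) :
    leftMul δ (leftEps δ p) = leftEps δ * leftMul δ p := by
  induction p using Polynomial.induction_on' with
  | add p q hp hq => simp only [map_add, mul_add, hp, hq]
  | monomial k a =>
    rw [leftEps_monomial, map_add, leftMul_monomial, leftMul_monomial, leftMul_monomial,
      ← mul_assoc, leftEps_mul_leftCoeff, add_mul, mul_assoc, pow_succ']

theorem leftMul_leftEps_pow (k : ℕ) (p : Polynomial A) :
    leftMul δ ((leftEps δ ^ k) p) = leftEps δ ^ k * leftMul δ p := by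
  induction k with
  | zero => simp
  | succ k ih => rw [pow_succ', AddMonoid.End.coe_mul, Function.comp_apply, leftMul_leftEps, ih,
      mul_assoc]

theorem leftMul_leftCoeff (a : A) (p : Polynomial A) :
    leftMul δ (leftCoeff a p) = leftCoeff a * leftMul δ p := by
  induction p using Polynomial.induction_on' with
  | add p q hp hq => simp only [map_add, mul_add, hp, hq]
  | monomial k b =>
    rw [leftCoeff_monomial, leftMul_monomial, leftMul_monomial, map_mul, mul_assoc]

theorem leftMul_leftMul (p q : Polynomial A) :
    leftMul δ (leftMul δ p q) = leftMul δ p * leftMul δ q := by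
  induction p using Polynomial.induction_on' with
  | add p p' hp hp' =>
    rw [leftMul_add_apply, map_add, map_add, add_mul, hp, hp']
  | monomial k a =>
    rw [leftMul_monomial, AddMonoid.End.coe_mul, Function.comp_apply, leftMul_leftCoeff,
      leftMul_leftEps_pow, mul_assoc]

theorem leftMul_one : leftMul δ 1 = 1 := by
  rw [← Polynomial.monomial_zero_one, leftMul_monomial, map_one, pow_zero, one_mul]

theorem leftEps_pow_one (k : ℕ) :
    (leftEps δ ^ k) (Polynomial.monomial 0 1) = Polynomial.monomial k 1 := by
  induction k with
  | zero => simp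
  | succ k ih =>
    rw [pow_succ', AddMonoid.End.coe_mul, Function.comp_apply, ih, leftEps_monomial]
    simp

theorem leftMul_apply_one (p : Polynomial A) : leftMul δ p 1 = p := by
  rw [← Polynomial.monomial_zero_one]
  induction p using Polynomial.induction_on' with
  | add p q hp hq => rw [leftMul_add_apply, hp, hq]
  | monomial k a =>
    rw [leftMul_monomial, AddMonoid.End.coe_mul, Function.comp_apply, leftEps_pow_one,
      leftCoeff_monomial, mul_one]

instance : Mul (DiffOp δ) := ⟨fun L M => symbol.symm (leftMul δ (symbol L) (symbol M))⟩

instance : One (DiffOp δ) := ⟨symbol.symm 1⟩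

theorem symbol_mul (L M : DiffOp δ) : symbol (L * M) = leftMul δ (symbol L) (symbol M) := rfl

theorem symbol_one : symbol (1 : DiffOp δ) = 1 := rfl

/-- The noncommutative ring of differential operators. -/
instance : Ring (DiffOp δ) where
  left_distrib L M N := symbol_injective (by simp only [symbol_mul, map_add])
  right_distrib L M N := symbol_injective (by
    rw [map_add, symbol_mul, symbol_mul, symbol_mul, map_add, leftMul_add_apply])
  zero_mul L := symbol_injective (by rw [symbol_mul, map_zero, leftMul_zero_apply])
  mul_zero L := symbol_injective (by simp only [symbol_mul, map_zero])
  mul_assoc L M N := symbol_injective (by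
    simp only [symbol_mul, leftMul_leftMul, AddMonoid.End.coe_mul, Function.comp_apply])
  one_mul L := symbol_injective (by
    rw [symbol_mul, symbol_one, leftMul_one, AddMonoid.End.coe_one, id])
  mul_one L := symbol_injective (by rw [symbol_mul, symbol_one, leftMul_apply_one])
  neg_add_cancel := neg_add_cancel
  zsmul := zsmulRec

/-- The symbol `ε`. -/
def eps : DiffOp δ := symbol.symm Polynomial.X

/-- An element of the coefficient ring, as an operator of order zero (multiplication by `a`). -/
def func : A →+* DiffOp δ where
  toFun a := symbol.symm (Polynomial.C a)
  map_one' := symbol_injective (by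
    rw [AddEquiv.apply_symm_apply, symbol_one, Polynomial.C_1])
  map_zero' := symbol_injective (by simp)
  map_add' a b := symbol_injective (by simp)
  map_mul' a b := symbol_injective (by
    rw [symbol_mul]
    simp only [AddEquiv.apply_symm_apply, ← Polynomial.monomial_zero_left]
    rw [leftMul_monomial, pow_zero, mul_one, leftCoeff_monomial])

theorem symbol_eps : symbol (eps : DiffOp δ) = Polynomial.monomial 1 1 := by
  rw [eps, AddEquiv.apply_symm_apply, Polynomial.monomial_one_one_eq_X]

theorem symbol_func (a : A) : symbol (func a : DiffOp δ) = Polynomial.monomial 0 a := rfl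

/-- The commutation rule. -/
theorem eps_mul_func (a : A) : (eps : DiffOp δ) * func a = func a * eps + func (δ a) := by
  apply symbol_injective
  rw [map_add, symbol_mul, symbol_mul, symbol_eps, symbol_func, symbol_func, leftMul_monomial,
    leftMul_monomial]
  rw [map_one, one_mul, pow_one, pow_zero, mul_one, leftEps_monomial, leftCoeff_monomial, mul_one]

/-- The standard form `L = ∑ aₖ εᵏ`. -/
theorem eq_sum (L : DiffOp δ) : L = (symbol L).sum fun k a => func a * eps ^ k := by
  have heps : ∀ k, symbol ((eps : DiffOp δ) ^ k) = Polynomial.monomial k 1 := by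
    intro k
    induction k with
    | zero => rw [pow_zero, symbol_one, Polynomial.monomial_zero_one]
    | succ k ih =>
      rw [pow_succ', symbol_mul, ih, symbol_eps, leftMul_monomial, map_one, one_mul, pow_one,
        leftEps_monomial, Derivation.map_one_eq_zero, map_zero, add_zero]
  apply symbol_injective
  rw [Polynomial.sum_def, map_sum]
  conv_lhs => rw [← Polynomial.sum_monomial_eq (symbol L), Polynomial.sum_def]
  refine Finset.sum_congr rfl fun k _ => ?_
  rw [symbol_mul, heps, symbol_func, leftMul_monomial, pow_zero, mul_one, leftCoeff_monomial,
    mul_one]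

/-- The order of an operator, i.e. the highest power of `ε` present in its standard form (`0` for
the zero operator). -/
def order (L : DiffOp δ) : ℕ := (symbol L).natDegree

end DiffOp

end Operators

/-! ### Fuchsian operators -/

open DiffOp

/-- Differential operators `∑ aₖ(t) εᵏ` with holomorphic coefficients, `ε = t d/dt`. -/
abbrev Op : Type := DiffOp euler

/-- An operator with holomorphic coefficients is Fuchsian if its leading coefficient does not
vanish at the origin. -/
def IsFuchsian (L : Op) : Prop := value (symbol L).leadingCoeff ≠ 0

/-- The Euler part: the coefficients are replaced by their values at `t = 0`, i.e. only the term
`p₀` of the expansion `∑ tʲ pⱼ(ε)` is retained. -/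
def eulerPart (L : Op) : Polynomial ℂ := (symbol L).map value

/-- `F`-equivalence of operators of the same order: `M H = K L` with Fuchsian `H`, `K` of
arbitrary orders, the Euler parts of `H` and `L` being relatively prime. -/
def FEquiv (L M : Op) : Prop :=
  order L = order M ∧
    ∃ H K : Op, IsFuchsian H ∧ IsFuchsian K ∧ M * H = K * L ∧
      IsCoprime (eulerPart H) (eulerPart L)

/-- The natural numbers which are differences of two (possibly equal) roots of `p`. -/
def rootDifferences (p : Polynomial ℂ) : Set ℕ :=
  {j | ∃ a b : ℂ, p.IsRoot a ∧ p.IsRoot b ∧ b - a = j}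

theorem rootDifferences_finite {p : Polynomial ℂ} (hp : p ≠ 0) : (rootDifferences p).Finite := by
  have h : {a : ℂ | p.IsRoot a}.Finite := Polynomial.finite_setOfPred_isRoot hp
  refine ((h.prod h).image fun x : ℂ × ℂ => x.2 - x.1).preimage
    (f := (Nat.cast : ℕ → ℂ)) Nat.cast_injective.injOn |>.subset ?_
  rintro j ⟨a, b, ha, hb, hj⟩
  exact ⟨(a, b), ⟨ha, hb⟩, hj⟩

/-- The maximal natural difference between roots of the nonzero polynomial `p`; it is `0` if no two
distinct roots differ by an integer. -/
def maxResonance (p : Polynomial ℂ) : ℕ := sSup (rootDifferences p)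

/-- The first order operator `ε - c + r(t)`. -/
def factor (c : ℂ) (r : Polynomial ℂ) : Op :=
  eps - func (algebraMap ℂ Hol c) + func (ofPoly r)

end Fuchs

end

/-!
The Euler part is multiplicative, and an operator `P` acts on the ring of germs by letting `ε` act
as `δ + b`, for any germ `b`; `ε - b` is a right factor of `P` exactly when `P` annihilates `1` in this
action. The analytic input is one solvability statement, `IsFuchsian.exists_act_eq`: if the Euler
part of a Fuchsian operator does not vanish at `b(0) + k` for any `k ≥ m`, then `P g = h` has a
solution `g` in the germs of order at least `m` for each such `h`. In the basis of powers of `t` the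
equation is triangular, and the formal solution converges because the diagonal entries grow as fast
as the remaining ones are allowed to by `GrowthBound.act`.

The proof uses solvability twice. Applied at an exponent of maximal real part it produces a
holomorphic solution, hence a right factor of first order, so that `L` is a unit times a product of
operators `ε - b` with holomorphic `b` (`IsFuchsian.exists_eq_func_mul_linearProd`). The
coefficients are then replaced by polynomials one at a time, starting from the right
(`exists_extension`). Suppose `M H = K P` is an equivalence between `P` and its normal form `M`, and
consider `(ε - b) P`. In the ansatz
`(ε - b(0) + r) M (H + g P) = (ε - b(0) + r) (K + M g) P` the right-hand side is a left multiple of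
`(ε - b) P` as soon as `(ε - b(0) + r) M g = -(ε - b(0) + r) f` in the action with `ε` acting as
`δ + b`, where `f = K 1`. Coprimality makes `f(0) ≠ 0`, so that the coefficients of `r` in degrees
`1, …, N` can be chosen to make the right-hand side of order greater than `N`; beyond `N` there are
no resonances, and the equation for `g` is solvable.
-/

noncomputable section

namespace Fuchs

open scoped PowerSeries

/-! ### The ring of differential operators -/

namespace DiffOp

section Ring

variable {A : Type*} [CommRing A] [Algebra ℂ A] {δ : Derivation ℂ A A}

/-- The universal property of the ring of differential operators: a ring homomorphism `φ` from the
coefficient ring, together with an element `e` that satisfies the commutation rule of `ε`, extends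
to all operators by `ε ↦ e`. -/
def lift {R : Type*} [Ring R] (φ : A →+* R) (e : R)
    (h : ∀ a, e * φ a = φ a * e + φ (δ a)) : DiffOp δ →+* R :=
  have heps : ∀ p : Polynomial A, (leftEps δ p).eval₂ φ e = e * p.eval₂ φ e := by
    intro p
    induction p using Polynomial.induction_on' with
    | add p q hp hq => rw [map_add, Polynomial.eval₂_add, Polynomial.eval₂_add, hp, hq, mul_add]
    | monomial k a =>
      rw [leftEps_monomial, Polynomial.eval₂_add]
      simp only [Polynomial.eval₂_monomial]
      rw [← mul_assoc, h, add_mul, pow_succ', mul_assoc]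
  have hcoeff : ∀ (a : A) (p : Polynomial A),
      (leftCoeff a p).eval₂ φ e = φ a * p.eval₂ φ e := by
    intro a p
    induction p using Polynomial.induction_on' with
    | add p q hp hq => rw [map_add, Polynomial.eval₂_add, Polynomial.eval₂_add, hp, hq, mul_add]
    | monomial k b =>
      rw [leftCoeff_monomial]
      simp only [Polynomial.eval₂_monomial]
      rw [map_mul, mul_assoc]
  have hpow : ∀ (k : ℕ) (p : Polynomial A),
      ((leftEps δ ^ k) p).eval₂ φ e = e ^ k * p.eval₂ φ e := by
    intro k p
    induction k with
    | zero => simp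
    | succ k ih =>
      rw [pow_succ', AddMonoid.End.coe_mul, Function.comp_apply, heps, ih, pow_succ', mul_assoc]
  { toFun := fun L => (symbol L).eval₂ φ e
    map_one' := by rw [symbol_one, Polynomial.eval₂_one]
    map_zero' := by rw [map_zero, Polynomial.eval₂_zero]
    map_add' := fun L M => by rw [map_add, Polynomial.eval₂_add]
    map_mul' := fun L M => by
      rw [symbol_mul]
      induction symbol L using Polynomial.induction_on' with
      | add p q hp hq => rw [leftMul_add_apply, Polynomial.eval₂_add, Polynomial.eval₂_add, hp, hq,
          add_mul]
      | monomial k a =>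
        rw [leftMul_monomial, AddMonoid.End.coe_mul, Function.comp_apply, hcoeff, hpow,
          Polynomial.eval₂_monomial, mul_assoc] }

theorem lift_apply {R : Type*} [Ring R] (φ : A →+* R) (e : R)
    (h : ∀ a, e * φ a = φ a * e + φ (δ a)) (L : DiffOp δ) :
    lift φ e h L = (symbol L).eval₂ φ e := rfl

/-- The action of differential operators on the coefficient ring in which `ε` acts as `δ + b`:
the action on the multiples `y v` of a formal symbol `v` with `ε v = b v`. -/
def act (b : A) : DiffOp δ →+* Module.End ℂ A :=
  lift (Algebra.lmul ℂ A : A →+* Module.End ℂ A) (δ.toLinearMap + Algebra.lmul ℂ A b) <| by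
    intro a
    ext x
    simp
    ring

theorem act_func (b a y : A) : act b (func a : DiffOp δ) y = a * y := by
  rw [act, lift_apply, symbol_func, Polynomial.eval₂_monomial, pow_zero, mul_one]
  rfl

theorem act_eps (b y : A) : act b (eps : DiffOp δ) y = δ y + b * y := by
  rw [act, lift_apply, symbol_eps, Polynomial.eval₂_monomial, pow_one, map_one, one_mul]
  rfl

theorem act_mul (b : A) (L M : DiffOp δ) (y : A) : act b (L * M) y = act b L (act b M y) := by
  rw [map_mul]
  rfl

theorem act_add (b : A) (L M : DiffOp δ) (y : A) : act b (L + M) y = act b L y + act b M y := by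
  rw [map_add]
  rfl

theorem act_sub (b : A) (L M : DiffOp δ) (y : A) : act b (L - M) y = act b L y - act b M y := by
  rw [map_sub]
  rfl

/-- Operators are generated by the coefficients under addition and composition with `ε` and with
coefficients on the left. -/
theorem induction_on {motive : DiffOp δ → Prop} (L : DiffOp δ) (one : motive 1)
    (add : ∀ L M, motive L → motive M → motive (L + M))
    (func_mul : ∀ a L, motive L → motive (func a * L))
    (eps_mul : ∀ L, motive L → motive (eps * L)) : motive L := by
  have heps : ∀ k : ℕ, motive (eps ^ k) := by
    intro k
    induction k with
    | zero => simpa using one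
    | succ k ih =>
      rw [pow_succ']
      exact eps_mul _ ih
  rw [eq_sum L, Polynomial.sum_def]
  refine Finset.sum_induction _ motive add ?_ fun k _ => func_mul _ _ (heps k)
  simpa using func_mul 0 1 one

/-- Right division by a monic operator of first order. -/
theorem exists_eq_mul_add (b : A) (L : DiffOp δ) :
    ∃ (Q : DiffOp δ) (c : A), L = Q * (eps - func b) + func c := by
  induction L using induction_on with
  | one => exact ⟨0, 1, by simp⟩
  | add L M hL hM =>
    obtain ⟨Q, c, rfl⟩ := hL
    obtain ⟨S, d, rfl⟩ := hM
    refine ⟨Q + S, c + d, ?_⟩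
    rw [map_add, add_mul]
    abel
  | func_mul a L hL =>
    obtain ⟨Q, c, rfl⟩ := hL
    exact ⟨func a * Q, a * c, by rw [map_mul, mul_add, mul_assoc]⟩
  | eps_mul L hL =>
    obtain ⟨Q, c, rfl⟩ := hL
    refine ⟨eps * Q + func c, c * b + δ c, ?_⟩
    rw [mul_add, eps_mul_func, map_add, map_mul, add_mul, mul_sub (func c), mul_assoc]
    abel

theorem act_eps_sub_func (b c y : A) :
    act b (eps - func c : DiffOp δ) y = δ y + b * y - c * y := by
  rw [act_sub, act_eps, act_func]

/-- An operator annihilates a solution of `(ε - c) y = 0` only if `ε - c` is a right factor. -/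
theorem exists_eq_mul_of_act_eq_zero [NoZeroDivisors A] {b c y : A} (hy : y ≠ 0)
    (h : δ y + b * y = c * y) {L : DiffOp δ} (hL : act b L y = 0) :
    ∃ Q : DiffOp δ, L = Q * (eps - func c) := by
  obtain ⟨Q, d, rfl⟩ := exists_eq_mul_add c L
  rw [act_add, act_mul, act_eps_sub_func, h, sub_self, map_zero, zero_add, act_func] at hL
  refine ⟨Q, ?_⟩
  rw [(mul_eq_zero.1 hL).resolve_right hy, map_zero, add_zero]

theorem coeff_leftEps (p : Polynomial A) (k : ℕ) :
    (leftEps δ p).coeff k = (Polynomial.X * p).coeff k + δ (p.coeff k) := by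
  induction p using Polynomial.induction_on' with
  | add p q hp hq =>
    rw [map_add, Polynomial.coeff_add, hp, hq, mul_add, Polynomial.coeff_add,
      Polynomial.coeff_add, map_add]
    abel
  | monomial j a =>
    rw [leftEps_monomial, Polynomial.coeff_add, Polynomial.X_mul_monomial]
    congr 1
    rw [Polynomial.coeff_monomial, Polynomial.coeff_monomial]
    split_ifs <;> simp

theorem leftEps_pow_top {n : ℕ} {p : Polynomial A} (hp : p.natDegree ≤ n) (k : ℕ) :
    ((leftEps δ ^ k) p).natDegree ≤ k + n ∧ ((leftEps δ ^ k) p).coeff (k + n) = p.coeff n := by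
  induction k with
  | zero => simpa using hp
  | succ k ih =>
    rw [pow_succ', AddMonoid.End.coe_mul, Function.comp_apply]
    set q := (leftEps δ ^ k) p
    have hq : ∀ j, k + n < j → q.coeff j = 0 := fun j hj =>
      Polynomial.coeff_eq_zero_of_natDegree_lt (ih.1.trans_lt hj)
    constructor
    · rw [Polynomial.natDegree_le_iff_coeff_eq_zero]
      intro j hj
      obtain ⟨i, rfl⟩ : ∃ i, j = i + 1 := ⟨j - 1, by omega⟩
      rw [coeff_leftEps, Polynomial.coeff_X_mul, hq i (by omega), hq (i + 1) (by omega),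
        map_zero, add_zero]
    · rw [show k + 1 + n = k + n + 1 by ring, coeff_leftEps, Polynomial.coeff_X_mul,
        hq (k + n + 1) (by omega), map_zero, add_zero, ih.2]

theorem leftMul_sum_apply {ι : Type*} (s : Finset ι) (f : ι → Polynomial A) (q : Polynomial A) :
    leftMul δ (∑ i ∈ s, f i) q = ∑ i ∈ s, leftMul δ (f i) q := by
  classical
  induction s using Finset.induction_on with
  | empty => simp only [Finset.sum_empty, leftMul_zero_apply]
  | insert i s hi ih =>
    rw [Finset.sum_insert hi, Finset.sum_insert hi, leftMul_add_apply, ih]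

theorem symbol_mul_top {m n : ℕ} {L M : DiffOp δ} (hL : (symbol L).natDegree ≤ m)
    (hM : (symbol M).natDegree ≤ n) :
    (symbol (L * M)).natDegree ≤ m + n ∧
      (symbol (L * M)).coeff (m + n) = (symbol L).coeff m * (symbol M).coeff n := by
  have h : symbol (L * M) = ∑ i ∈ Finset.range (m + 1),
      (symbol L).coeff i • (leftEps δ ^ i) (symbol M) := by
    rw [symbol_mul]
    conv_lhs => rw [(symbol L).as_sum_range' (m + 1) (by omega)]
    rw [leftMul_sum_apply]
    refine Finset.sum_congr rfl fun i _ => ?_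
    rw [leftMul_monomial]
    rfl
  rw [h]
  constructor
  · refine Polynomial.natDegree_sum_le_of_forall_le _ _ fun i hi => ?_
    refine (Polynomial.natDegree_smul_le _ _).trans ((leftEps_pow_top hM i).1.trans ?_)
    have := Finset.mem_range.1 hi
    omega
  · rw [Polynomial.finsetSum_coeff, Finset.sum_range_succ, Finset.sum_eq_zero, zero_add,
      Polynomial.coeff_smul, (leftEps_pow_top hM m).2, smul_eq_mul]
    intro i hi
    rw [Polynomial.coeff_smul, Polynomial.coeff_eq_zero_of_natDegree_lt (n := m + n), smul_zero]
    have := Finset.mem_range.1 hi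
    exact (leftEps_pow_top hM i).1.trans_lt (by omega)

theorem leadingCoeff_symbol_mul [NoZeroDivisors A] (L M : DiffOp δ) :
    (symbol (L * M)).leadingCoeff = (symbol L).leadingCoeff * (symbol M).leadingCoeff := by
  rcases eq_or_ne (symbol L) 0 with hL | hL
  · rw [symbol_mul, hL, leftMul_zero_apply, Polynomial.leadingCoeff_zero, zero_mul]
  rcases eq_or_ne (symbol M) 0 with hM | hM
  · rw [symbol_mul, hM, map_zero, Polynomial.leadingCoeff_zero, mul_zero]
  have h := symbol_mul_top (L := L) (M := M) le_rfl le_rfl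
  have h0 : (symbol L).leadingCoeff * (symbol M).leadingCoeff ≠ 0 :=
    mul_ne_zero (Polynomial.leadingCoeff_ne_zero.2 hL) (Polynomial.leadingCoeff_ne_zero.2 hM)
  have hd : (symbol (L * M)).natDegree = (symbol L).natDegree + (symbol M).natDegree :=
    Polynomial.natDegree_eq_of_le_of_coeff_ne_zero h.1 (h.2.trans_ne h0)
  rw [Polynomial.leadingCoeff, hd, h.2]
  rfl

theorem order_mul [NoZeroDivisors A] {L M : DiffOp δ} (hL : symbol L ≠ 0) (hM : symbol M ≠ 0) :
    order (L * M) = order L + order M := by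
  have h := symbol_mul_top (L := L) (M := M) le_rfl le_rfl
  exact Polynomial.natDegree_eq_of_le_of_coeff_ne_zero h.1 (h.2.trans_ne
    (mul_ne_zero (Polynomial.leadingCoeff_ne_zero.2 hL) (Polynomial.leadingCoeff_ne_zero.2 hM)))

end Ring

end DiffOp

open DiffOp

open Finset.HasAntidiagonal (antidiagonal mem_antidiagonal)

/-! ### Euler parts and Fuchsian operators -/

/-- The `n`-th Taylor coefficient of a holomorphic germ. -/
def taylor (n : ℕ) : Hol →ₗ[ℂ] ℂ := (PowerSeries.coeff n).comp Hol.val.toLinearMap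

theorem taylor_apply (n : ℕ) (f : Hol) : taylor n f = PowerSeries.coeff n (f : ℂ⟦X⟧) := rfl

theorem taylor_zero (f : Hol) : taylor 0 f = value f :=
  PowerSeries.coeff_zero_eq_constantCoeff_apply _

theorem taylor_ext {f g : Hol} (h : ∀ n, taylor n f = taylor n g) : f = g :=
  Subtype.ext (PowerSeries.ext h)

theorem taylor_mul (n : ℕ) (f g : Hol) :
    taylor n (f * g) = ∑ p ∈ antidiagonal n, taylor p.1 f * taylor p.2 g :=
  PowerSeries.coeff_mul n _ _

theorem taylor_euler (n : ℕ) (f : Hol) : taylor n (euler f) = n * taylor n f := by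
  change PowerSeries.coeff n (PowerSeries.X * PowerSeries.derivative ℂ (f : ℂ⟦X⟧)) = _
  cases n with
  | zero => simp
  | succ n =>
    rw [PowerSeries.coeff_succ_X_mul, PowerSeries.coeff_derivative, taylor_apply]
    push_cast
    ring

theorem value_euler (f : Hol) : value (euler f) = 0 := by
  rw [← taylor_zero, taylor_euler, Nat.cast_zero, zero_mul]

theorem taylor_one (n : ℕ) : taylor n 1 = if n = 0 then 1 else 0 := by
  rw [taylor_apply, Subalgebra.coe_one, PowerSeries.coeff_one]

theorem taylor_natCast_mul (n i : ℕ) (f : Hol) : taylor n ((i : Hol) * f) = i * taylor n f := by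
  rw [← nsmul_eq_mul, map_nsmul, nsmul_eq_mul]

theorem value_algebraMap (c : ℂ) : value (algebraMap ℂ Hol c) = c := by
  change PowerSeries.constantCoeff (algebraMap ℂ ℂ⟦X⟧ c) = c
  simp

theorem value_ofPoly (p : Polynomial ℂ) : value (ofPoly p) = p.eval 0 := by
  change PowerSeries.constantCoeff (p : ℂ⟦X⟧) = _
  rw [Polynomial.constantCoeff_coe, Polynomial.coeff_zero_eq_eval_zero]

/-- Taking the Euler part is a ring homomorphism, because `δ f` vanishes at the origin. -/
def eulerHom : Op →+* Polynomial ℂ :=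
  lift (Polynomial.C.comp value) Polynomial.X fun a => by
    rw [RingHom.comp_apply, RingHom.comp_apply, value_euler, Polynomial.C_0, add_zero, mul_comm]

theorem eulerHom_apply (L : Op) : eulerHom L = eulerPart L := rfl

theorem eulerPart_mul (L M : Op) : eulerPart (L * M) = eulerPart L * eulerPart M :=
  map_mul eulerHom L M

theorem eulerPart_add (L M : Op) : eulerPart (L + M) = eulerPart L + eulerPart M :=
  map_add eulerHom L M

theorem eulerPart_func (a : Hol) : eulerPart (func a) = Polynomial.C (value a) := by
  rw [eulerPart, symbol_func, Polynomial.map_monomial, Polynomial.monomial_zero_left]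

theorem eulerPart_eps : eulerPart eps = Polynomial.X := by
  rw [eulerPart, symbol_eps, Polynomial.map_monomial, map_one, Polynomial.monomial_one_one_eq_X]

theorem eulerPart_eps_sub_func (b : Hol) :
    eulerPart (eps - func b) = Polynomial.X - Polynomial.C (value b) := by
  rw [← eulerHom_apply, map_sub, eulerHom_apply, eulerHom_apply, eulerPart_eps, eulerPart_func]

theorem isFuchsian_mul_iff {L M : Op} : IsFuchsian (L * M) ↔ IsFuchsian L ∧ IsFuchsian M := by
  rw [IsFuchsian, leadingCoeff_symbol_mul, map_mul, mul_ne_zero_iff]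
  rfl

theorem IsFuchsian.symbol_ne_zero {L : Op} (h : IsFuchsian L) : symbol L ≠ 0 := by
  intro h0
  rw [IsFuchsian, h0, Polynomial.leadingCoeff_zero, map_zero] at h
  exact h rfl

theorem IsFuchsian.order_mul {L M : Op} (hL : IsFuchsian L) (hM : IsFuchsian M) :
    order (L * M) = order L + order M :=
  DiffOp.order_mul hL.symbol_ne_zero hM.symbol_ne_zero

theorem IsFuchsian.natDegree_eulerPart {L : Op} (h : IsFuchsian L) :
    (eulerPart L).natDegree = order L :=
  Polynomial.natDegree_map_of_leadingCoeff_ne_zero _ h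

theorem IsFuchsian.eulerPart_ne_zero {L : Op} (h : IsFuchsian L) : eulerPart L ≠ 0 := by
  intro h0
  have h1 := congrArg (fun p => p.coeff (order L)) h0
  simp only [eulerPart, Polynomial.coeff_map, Polynomial.coeff_zero] at h1
  exact h h1

theorem isFuchsian_func {a : Hol} (ha : value a ≠ 0) : IsFuchsian (func a) := by
  rw [IsFuchsian, symbol_func, Polynomial.leadingCoeff_monomial]
  exact ha

theorem order_func (a : Hol) : order (func a : Op) = 0 := by
  rw [order, symbol_func, Polynomial.monomial_zero_left, Polynomial.natDegree_C]

theorem symbol_eps_sub_func (b : Hol) :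
    symbol (eps - func b : Op) = Polynomial.X - Polynomial.C b := by
  rw [map_sub, symbol_eps, symbol_func, Polynomial.monomial_one_one_eq_X,
    Polynomial.monomial_zero_left]

theorem isFuchsian_eps_sub_func (b : Hol) : IsFuchsian (eps - func b) := by
  rw [IsFuchsian, symbol_eps_sub_func, Polynomial.leadingCoeff_X_sub_C, map_one]
  exact one_ne_zero

theorem order_eps_sub_func (b : Hol) : order (eps - func b : Op) = 1 := by
  rw [order, symbol_eps_sub_func, Polynomial.natDegree_X_sub_C]

theorem value_act (b : Hol) (L : Op) (y : Hol) :
    value (act b L y) = (eulerPart L).eval (value b) * value y := by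
  induction L using DiffOp.induction_on with
  | one =>
    rw [← map_one func, act_func, eulerPart_func, Polynomial.eval_C, map_mul]
  | add L M hL hM =>
    rw [act_add, map_add, hL, hM, eulerPart_add, Polynomial.eval_add, add_mul]
  | func_mul a L hL =>
    rw [act_mul, act_func, map_mul, hL, eulerPart_mul, eulerPart_func, Polynomial.eval_mul,
      Polynomial.eval_C, mul_assoc]
  | eps_mul L hL =>
    rw [act_mul, act_eps, map_add, value_euler, zero_add, map_mul, hL, eulerPart_mul,
      eulerPart_eps, Polynomial.eval_mul, Polynomial.eval_X, mul_assoc]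

/-! ### The matrix of a differential operator in the basis of powers of `t` -/

theorem taylor_mul_of_kernel {c : ℕ → Hol} {F g : Hol}
    (hF : ∀ j, taylor j F = ∑ p ∈ antidiagonal j, taylor p.2 (c p.1) * taylor p.1 g)
    (a : Hol) (j : ℕ) :
    taylor j (a * F) = ∑ p ∈ antidiagonal j, taylor p.2 (a * c p.1) * taylor p.1 g := by
  simp only [taylor_mul, hF, Finset.mul_sum, Finset.sum_mul]
  rw [Finset.sum_sigma', Finset.sum_sigma']
  refine Finset.sum_nbij' (fun x => ⟨(x.2.1, x.1.1 + x.2.2), (x.1.1, x.2.2)⟩)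
    (fun x => ⟨(x.2.1, x.1.1 + x.2.2), (x.1.1, x.2.2)⟩) ?_ ?_ ?_ ?_ ?_
  · rintro ⟨⟨u, v⟩, ⟨i, l⟩⟩ h
    simp only [Finset.mem_sigma, mem_antidiagonal] at h ⊢
    obtain ⟨rfl, rfl⟩ := h
    exact ⟨add_left_comm _ _ _, trivial⟩
  · rintro ⟨⟨u, v⟩, ⟨i, l⟩⟩ h
    simp only [Finset.mem_sigma, mem_antidiagonal] at h ⊢
    obtain ⟨rfl, rfl⟩ := h
    exact ⟨add_left_comm _ _ _, trivial⟩
  · rintro ⟨⟨u, v⟩, ⟨i, l⟩⟩ h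
    simp only [Finset.mem_sigma, mem_antidiagonal] at h ⊢
    obtain ⟨-, rfl⟩ := h
    rfl
  · rintro ⟨⟨u, v⟩, ⟨i, l⟩⟩ h
    simp only [Finset.mem_sigma, mem_antidiagonal] at h ⊢
    obtain ⟨-, rfl⟩ := h
    rfl
  · rintro ⟨⟨u, v⟩, ⟨i, l⟩⟩ -
    exact (mul_assoc _ _ _).symm

/-- The matrix of an operator: `L (∑ gᵢ tⁱ) = ∑ gᵢ tⁱ cᵢ(t)`, where the germ `cᵢ = t⁻ⁱ L tⁱ` is
obtained by letting `L` with the shift `ε ↦ ε + i` act on `1`. -/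
theorem taylor_act (b : Hol) (L : Op) (g : Hol) (j : ℕ) :
    taylor j (act b L g) =
      ∑ p ∈ antidiagonal j, taylor p.2 (act (b + (p.1 : Hol)) L 1) * taylor p.1 g := by
  induction L using DiffOp.induction_on generalizing j with
  | one =>
    simp only [map_one, Module.End.one_apply]
    rw [← mul_one g, mul_comm, taylor_mul, ← Finset.Nat.sum_antidiagonal_swap]
    simp
  | add L M hL hM =>
    simp only [act_add, LinearMap.map_add, hL, hM, add_mul, Finset.sum_add_distrib]
  | func_mul a L hL =>
    simp only [act_mul, act_func]
    exact taylor_mul_of_kernel (c := fun i => act (b + (i : Hol)) L 1) hL a j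
  | eps_mul L hL =>
    simp only [act_mul, act_eps, LinearMap.map_add]
    rw [taylor_mul_of_kernel (c := fun i => act (b + (i : Hol)) L 1) hL b j, taylor_euler,
      hL, Finset.mul_sum, ← Finset.sum_add_distrib]
    refine Finset.sum_congr rfl fun p hp => ?_
    rw [add_mul b, map_add, taylor_euler, taylor_natCast_mul, ← mem_antidiagonal.1 hp]
    push_cast
    ring

/-- The Taylor coefficients of the germs `Fᵢ` grow at most geometrically, with a constant that is
of polynomial growth of degree `n` in the index `i`. -/
def GrowthBound (n : ℕ) (F : ℕ → Hol) : Prop :=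
  ∃ C R : ℝ, 0 ≤ C ∧ 1 ≤ R ∧ ∀ i l, ‖taylor l (F i)‖ ≤ C * R ^ l * ((i : ℝ) + 1) ^ n

namespace GrowthBound

theorem const (f : Hol) : GrowthBound 0 fun _ => f := by
  obtain ⟨C, R, hC, hR, h⟩ := f.2.exists_bound
  exact ⟨C, R, hC, hR, fun i l => by simpa [taylor_apply] using h l⟩

theorem natCast : GrowthBound 1 fun i => (i : Hol) := by
  refine ⟨1, 1, zero_le_one, le_rfl, fun i l => ?_⟩
  have h := taylor_natCast_mul l i 1
  rw [mul_one] at h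
  rw [h, taylor_one, norm_mul, Complex.norm_natCast]
  split_ifs <;> simp
  positivity

theorem mono {m n : ℕ} {F : ℕ → Hol} (hF : GrowthBound m F) (hmn : m ≤ n) : GrowthBound n F := by
  obtain ⟨C, R, hC, hR, h⟩ := hF
  refine ⟨C, R, hC, hR, fun i l => (h i l).trans ?_⟩
  gcongr
  linarith [(Nat.cast_nonneg i : (0 : ℝ) ≤ i)]

theorem add {n : ℕ} {F G : ℕ → Hol} (hF : GrowthBound n F) (hG : GrowthBound n G) :
    GrowthBound n fun i => F i + G i := by
  obtain ⟨C, R, hC, hR, hF⟩ := hF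
  obtain ⟨D, S, hD, hS, hG⟩ := hG
  refine ⟨C + D, max R S, by positivity, hR.trans (le_max_left _ _), fun i l => ?_⟩
  rw [map_add, add_mul, add_mul]
  refine norm_add_le_of_le ((hF i l).trans ?_) ((hG i l).trans ?_)
  · gcongr
    exact le_max_left _ _
  · gcongr
    exact le_max_right _ _

theorem mul {m n : ℕ} {F G : ℕ → Hol} (hF : GrowthBound m F) (hG : GrowthBound n G) :
    GrowthBound (m + n) fun i => F i * G i := by
  obtain ⟨C, R, hC, hR, hF⟩ := hF
  obtain ⟨D, S, hD, hS, hG⟩ := hG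
  refine ⟨C * D, 2 * (R * S), by positivity, by nlinarith, fun i l => ?_⟩
  rw [taylor_mul]
  have key : ∀ p ∈ antidiagonal l, ‖taylor p.1 (F i) * taylor p.2 (G i)‖ ≤
      C * D * (R * S) ^ l * ((i : ℝ) + 1) ^ (m + n) := by
    intro p hp
    have hp' := mem_antidiagonal.1 hp
    rw [norm_mul]
    calc ‖taylor p.1 (F i)‖ * ‖taylor p.2 (G i)‖
        ≤ (C * R ^ p.1 * ((i : ℝ) + 1) ^ m) * (D * S ^ p.2 * ((i : ℝ) + 1) ^ n) := by
          gcongr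
          · exact hF _ _
          · exact hG _ _
      _ ≤ (C * R ^ l * ((i : ℝ) + 1) ^ m) * (D * S ^ l * ((i : ℝ) + 1) ^ n) := by
          gcongr <;> first | assumption | omega
      _ = C * D * (R * S) ^ l * ((i : ℝ) + 1) ^ (m + n) := by rw [mul_pow, pow_add]; ring
  refine (norm_sum_le_of_le _ key).trans ?_
  rw [Finset.sum_const, Finset.Nat.card_antidiagonal, nsmul_eq_mul, mul_pow 2]
  have h2 : ((l + 1 : ℕ) : ℝ) ≤ 2 ^ l := by exact_mod_cast Nat.lt_two_pow_self
  calc ((l + 1 : ℕ) : ℝ) * (C * D * (R * S) ^ l * ((i : ℝ) + 1) ^ (m + n))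
      ≤ 2 ^ l * (C * D * (R * S) ^ l * ((i : ℝ) + 1) ^ (m + n)) := by
        gcongr
    _ = C * D * (2 ^ l * (R * S) ^ l) * ((i : ℝ) + 1) ^ (m + n) := by ring

theorem derivation {n : ℕ} {F : ℕ → Hol} (hF : GrowthBound n F) :
    GrowthBound n fun i => euler (F i) := by
  obtain ⟨C, R, hC, hR, hF⟩ := hF
  refine ⟨C, 2 * R, hC, by linarith, fun i l => ?_⟩
  rw [taylor_euler, norm_mul, Complex.norm_natCast, mul_pow]
  have h2 : (l : ℝ) ≤ 2 ^ l := by exact_mod_cast (Nat.lt_two_pow_self (n := l)).le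
  calc (l : ℝ) * ‖taylor l (F i)‖ ≤ 2 ^ l * (C * R ^ l * ((i : ℝ) + 1) ^ n) := by
        gcongr
        exact hF _ _
    _ = _ := by ring

theorem sum {n : ℕ} {ι : Type*} (s : Finset ι) {F : ι → ℕ → Hol}
    (hF : ∀ k ∈ s, GrowthBound n (F k)) : GrowthBound n fun i => ∑ k ∈ s, F k i := by
  classical
  induction s using Finset.induction_on with
  | empty => simpa using (const 0).mono (Nat.zero_le n)
  | insert k s hk ih =>
    simp only [Finset.sum_insert hk]
    exact (hF k (Finset.mem_insert_self k s)).add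
      (ih fun j hj => hF j (Finset.mem_insert_of_mem hj))

/-- The matrix of an operator has entries of at most geometric growth away from the diagonal; along
the diagonals the growth is polynomial, of degree the order of the operator. -/
theorem act (b : Hol) (L : Op) :
    GrowthBound (order L) fun i => DiffOp.act (b + (i : Hol)) L 1 := by
  have heps : ∀ k, GrowthBound k fun i => DiffOp.act (b + (i : Hol)) (eps ^ k : Op) 1 := by
    intro k
    induction k with
    | zero => simpa using const 1
    | succ k ih =>
      simp only [pow_succ', act_mul, act_eps, add_mul]
      refine (ih.derivation.mono k.le_succ).add (GrowthBound.add ?_ ?_)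
      · exact (((const b).mul ih).mono (by omega))
      · exact (natCast.mul ih).mono (by omega)
  have h : ∀ i : ℕ, DiffOp.act (b + (i : Hol)) L 1 = ∑ k ∈ (symbol L).support,
      (symbol L).coeff k * DiffOp.act (b + (i : Hol)) (eps ^ k : Op) 1 := by
    intro i
    conv_lhs => rw [eq_sum L, Polynomial.sum_def]
    rw [map_sum, LinearMap.sum_apply]
    simp only [act_mul, act_func]
  simp only [h]
  refine sum _ fun k hk => ((const _).mul (heps k)).mono ?_
  rw [zero_add]
  exact Polynomial.le_natDegree_of_mem_supp k hk

end GrowthBound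

/-! ### Solving nonresonant equations -/

theorem exists_le_mul_norm_add {z : ℂ} {m : ℕ} (h : ∀ k ≥ m, z + k ≠ 0) :
    ∃ C : ℝ, 0 ≤ C ∧ ∀ k : ℕ, m ≤ k → (k : ℝ) + 1 ≤ C * ‖z + k‖ := by
  set K : ℕ := ⌈2 * ‖z‖ + 1⌉₊
  have hS : 0 ≤ ∑ k ∈ Finset.range K, ((k : ℝ) + 1) / ‖z + k‖ :=
    Finset.sum_nonneg fun k _ => by positivity
  refine ⟨2 + ∑ k ∈ Finset.range K, ((k : ℝ) + 1) / ‖z + k‖, by positivity, fun k hk => ?_⟩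
  have hz : 0 < ‖z + k‖ := norm_pos_iff.2 (h k hk)
  rcases lt_or_ge k K with hkK | hkK
  · have h1 := Finset.single_le_sum (f := fun k : ℕ => ((k : ℝ) + 1) / ‖z + k‖)
      (fun _ _ => by positivity) (Finset.mem_range.2 hkK)
    calc (k : ℝ) + 1 = ((k : ℝ) + 1) / ‖z + k‖ * ‖z + k‖ := by field_simp
      _ ≤ _ := by
        gcongr
        linarith
  · have h1 : 2 * ‖z‖ + 1 ≤ k := Nat.ceil_le.1 hkK
    have h2 : (k : ℝ) ≤ ‖z + k‖ + ‖z‖ := by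
      have h3 := norm_sub_le (z + k) z
      rwa [add_sub_cancel_left, Complex.norm_natCast] at h3
    nlinarith

/-- A polynomial without zeros on an arithmetic progression `a + k`, `k ≥ m`, is bounded from below
there by the power of `k` given by its degree. -/
theorem exists_pow_le_mul_norm_eval {p : Polynomial ℂ} {a : ℂ} {m : ℕ}
    (h : ∀ k ≥ m, p.eval (a + k) ≠ 0) :
    ∃ C : ℝ, 0 ≤ C ∧ ∀ k : ℕ, m ≤ k →
      ((k : ℝ) + 1) ^ p.natDegree ≤ C * ‖p.eval (a + k)‖ := by
  have hp : p ≠ 0 := by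
    rintro rfl
    exact h m le_rfl Polynomial.eval_zero
  have key : ∀ s : Multiset ℂ, (∀ z ∈ s, ∀ k ≥ m, a + k - z ≠ 0) → ∃ C : ℝ, 0 ≤ C ∧
      ∀ k : ℕ, m ≤ k → ((k : ℝ) + 1) ^ s.card ≤ C * ‖(s.map fun z => a + k - z).prod‖ := by
    intro s
    induction s using Multiset.induction_on with
    | empty => exact fun _ => ⟨1, zero_le_one, fun k _ => by simp⟩
    | cons z s ih =>
      intro hs
      obtain ⟨C, hC, hCs⟩ := ih fun w hw => hs w (Multiset.mem_cons_of_mem hw)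
      obtain ⟨D, hD, hDz⟩ := exists_le_mul_norm_add (z := a - z) (m := m) fun k hk => by
        rw [sub_add_eq_add_sub]
        exact hs z (Multiset.mem_cons_self z s) k hk
      refine ⟨C * D, by positivity, fun k hk => ?_⟩
      rw [Multiset.card_cons, Multiset.map_cons, Multiset.prod_cons, norm_mul, pow_succ]
      have h2 := hDz k hk
      rw [sub_add_eq_add_sub] at h2
      calc ((k : ℝ) + 1) ^ s.card * ((k : ℝ) + 1)
          ≤ (C * ‖(s.map fun z => a + k - z).prod‖) * (D * ‖a + k - z‖) := by
            gcongr
            exact hCs k hk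
        _ = _ := by ring
  have heval : ∀ x, p.eval x = p.leadingCoeff * (p.roots.map fun z => x - z).prod :=
    fun x => (IsAlgClosed.splits p).eval_eq_prod_roots x
  obtain ⟨C, hC, hCp⟩ := key p.roots fun z hz k hk h0 => h k hk (by
    rw [sub_eq_zero.1 h0]
    exact (Polynomial.mem_roots hp).1 hz)
  have hl : 0 < ‖p.leadingCoeff‖ := norm_pos_iff.2 (Polynomial.leadingCoeff_ne_zero.2 hp)
  refine ⟨C / ‖p.leadingCoeff‖, by positivity, fun k hk => ?_⟩
  rw [(IsAlgClosed.splits p).natDegree_eq_card_roots, heval, norm_mul]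
  refine (hCp k hk).trans_eq ?_
  field_simp

/-- The formal solution of a triangular system `∑ c(i, j - i) gᵢ = hⱼ`, computed recursively. Where
the diagonal entry `c(j, 0)` vanishes, the junk value `x / 0 = 0` makes `gⱼ = 0`. -/
def triangularSolution (c : ℕ → ℕ → ℂ) (h : ℕ → ℂ) (j : ℕ) : ℂ :=
  (h j - ∑ i : Fin j, c i (j - i) * triangularSolution c h i) / c j 0
termination_by j
decreasing_by exact i.2

theorem triangularSolution_eq (c : ℕ → ℕ → ℂ) (h : ℕ → ℂ) (j : ℕ) :
    triangularSolution c h j =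
      (h j - ∑ i ∈ Finset.range j, c i (j - i) * triangularSolution c h i) / c j 0 := by
  rw [triangularSolution, Finset.sum_range]

theorem triangularSolution_eq_zero {c : ℕ → ℕ → ℂ} {h : ℕ → ℂ} {m : ℕ} (hh : ∀ j < m, h j = 0)
    (j : ℕ) (hj : j < m) : triangularSolution c h j = 0 := by
  induction j using Nat.strong_induction_on with
  | _ j ih =>
    rw [triangularSolution_eq, hh j hj, Finset.sum_eq_zero, sub_zero, zero_div]
    intro i hi
    have := Finset.mem_range.1 hi
    rw [ih i this (by omega), mul_zero]

theorem sum_triangularSolution {c : ℕ → ℕ → ℂ} {h : ℕ → ℂ} {m : ℕ} (hh : ∀ j < m, h j = 0)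
    (hc : ∀ j ≥ m, c j 0 ≠ 0) (j : ℕ) :
    ∑ p ∈ antidiagonal j, c p.1 p.2 * triangularSolution c h p.1 = h j := by
  rw [Finset.Nat.sum_antidiagonal_eq_sum_range_succ
    (fun i l => c i l * triangularSolution c h i)]
  rcases lt_or_ge j m with hj | hj
  · rw [hh j hj]
    refine Finset.sum_eq_zero fun i hi => ?_
    have := Finset.mem_range.1 hi
    rw [triangularSolution_eq_zero hh i (by omega), mul_zero]
  · rw [Finset.sum_range_succ, Nat.sub_self, triangularSolution_eq c h j,
      mul_div_cancel₀ _ (hc j hj)]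
    ring

/-- The formal solution converges: since the diagonal entries are bounded from below by the same
power of the index as that which bounds the other entries from above, the recursion is dominated by
a geometric one. -/
theorem exists_norm_triangularSolution_le {c : ℕ → ℕ → ℂ} {h : ℕ → ℂ} {m n : ℕ}
    (hh : ∀ j < m, h j = 0) {B : ℝ} (hB : 0 ≤ B)
    (hc0 : ∀ j : ℕ, m ≤ j → ((j : ℝ) + 1) ^ n ≤ B * ‖c j 0‖)
    {C R : ℝ} (hC : 0 ≤ C) (hR : 1 ≤ R)
    (hc : ∀ i l : ℕ, ‖c i l‖ ≤ C * R ^ l * ((i : ℝ) + 1) ^ n)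
    {D S : ℝ} (hD : 0 ≤ D) (hS : 0 ≤ S) (hhj : ∀ j, ‖h j‖ ≤ D * S ^ j) :
    ∃ A T : ℝ, 0 < T ∧ ∀ j, ‖triangularSolution c h j‖ ≤ A * T ^ j := by
  -- `T` is so large that the geometric sum below costs at most half of the bound.
  set T : ℝ := S + R + 2 * B * C * R with hT
  have hBCR : 0 ≤ B * C * R := by positivity
  have hTR : 0 < T := by nlinarith
  refine ⟨2 * (B * D), T, hTR, fun j => ?_⟩
  induction j using Nat.strong_induction_on with
  | _ j ih =>
    rcases lt_or_ge j m with hj | hj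
    · rw [triangularSolution_eq_zero hh j hj, norm_zero]
      positivity
    have hj1 : (1 : ℝ) ≤ ((j : ℝ) + 1) ^ n := one_le_pow₀ (by linarith [j.cast_nonneg (α := ℝ)])
    have hc0j := hc0 j hj
    have hpos : 0 < ‖c j 0‖ := by
      by_contra h0
      rw [le_antisymm (not_lt.1 h0) (norm_nonneg _), mul_zero] at hc0j
      linarith
    -- `R ^ j ≥ 0` is dropped from `∑ Rʲ⁻ⁱ Tⁱ = R (Tʲ - Rʲ) / (T - R)`.
    have hgeom : (∑ i ∈ Finset.range j, R ^ (j - i) * T ^ i) * (T - R) ≤ R * T ^ j := by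
      have h1 := (Commute.all T R).geom_sum₂_mul j
      have h2 : ∑ i ∈ Finset.range j, R ^ (j - i) * T ^ i =
          R * ∑ i ∈ Finset.range j, T ^ i * R ^ (j - 1 - i) := by
        rw [Finset.mul_sum]
        refine Finset.sum_congr rfl fun i hi => ?_
        have := Finset.mem_range.1 hi
        rw [show j - i = j - 1 - i + 1 by omega, pow_succ]
        ring
      rw [h2, mul_assoc, h1]
      have : 0 ≤ R ^ j := by positivity
      nlinarith
    have hsum : ‖∑ i ∈ Finset.range j, c i (j - i) * triangularSolution c h i‖ ≤
        C * ((j : ℝ) + 1) ^ n * (2 * (B * D)) * ∑ i ∈ Finset.range j, R ^ (j - i) * T ^ i := by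
      rw [Finset.mul_sum]
      refine norm_sum_le_of_le _ fun i hi => ?_
      have hij := Finset.mem_range.1 hi
      have hij' : (i : ℝ) ≤ j := by exact_mod_cast hij.le
      rw [norm_mul]
      calc ‖c i (j - i)‖ * ‖triangularSolution c h i‖
          ≤ (C * R ^ (j - i) * ((j : ℝ) + 1) ^ n) * (2 * (B * D) * T ^ i) := by
            gcongr
            · exact (hc i (j - i)).trans (by gcongr)
            · exact ih i hij
        _ = _ := by ring
    set G := ∑ i ∈ Finset.range j, R ^ (j - i) * T ^ i
    set J : ℝ := ((j : ℝ) + 1) ^ n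
    have hG0 : 0 ≤ G := Finset.sum_nonneg fun i _ => by positivity
    have hTj : 0 ≤ T ^ j := by positivity
    have hSj : S ^ j ≤ T ^ j := by
      gcongr
      linarith
    have hBCG : 2 * (B * C * G) ≤ T ^ j := by
      have h1 : 2 * (B * C) * G * R ≤ G * (T - R) := by
        rw [hT]
        nlinarith [mul_nonneg hG0 hS]
      have h2 : 2 * (B * C) * G * R ≤ R * T ^ j := h1.trans hgeom
      nlinarith
    rw [triangularSolution_eq, norm_div, div_le_iff₀ hpos]
    calc ‖h j - ∑ i ∈ Finset.range j, c i (j - i) * triangularSolution c h i‖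
        ≤ D * S ^ j + C * J * (2 * (B * D)) * G := norm_sub_le_of_le (hhj j) hsum
      _ ≤ D * T ^ j + D * J * T ^ j := by
          have h1 : D * J * (2 * (B * C * G)) ≤ D * J * T ^ j := by gcongr
          have h2 : D * S ^ j ≤ D * T ^ j := by gcongr
          linarith
      _ ≤ 2 * D * T ^ j * J := by
          have h1 : D * T ^ j * 1 ≤ D * T ^ j * J := by gcongr
          linarith
      _ ≤ 2 * D * T ^ j * (B * ‖c j 0‖) := by gcongr
      _ = 2 * (B * D) * T ^ j * ‖c j 0‖ := by ring

/-- A Fuchsian equation `L g = h` is solvable in the germs of order at least `m`, as long as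
the Euler part does not vanish at the exponents `b(0) + k`, `k ≥ m`. -/
theorem IsFuchsian.exists_act_eq {L : Op} (hL : IsFuchsian L) (b : Hol) {m : ℕ}
    (hm : ∀ k ≥ m, (eulerPart L).eval (value b + k) ≠ 0) {h : Hol}
    (hh : ∀ j < m, taylor j h = 0) :
    ∃ g : Hol, (∀ j < m, taylor j g = 0) ∧ act b L g = h := by
  obtain ⟨B, hB, hlow⟩ := exists_pow_le_mul_norm_eval hm
  rw [hL.natDegree_eulerPart] at hlow
  obtain ⟨C, R, hC, hR, hup⟩ := GrowthBound.act b L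
  obtain ⟨D, S, hD, hS, hhj⟩ := h.2.exists_bound
  set c : ℕ → ℕ → ℂ := fun i l => taylor l (act (b + (i : Hol)) L 1)
  have hc0 : ∀ i, c i 0 = (eulerPart L).eval (value b + i) := fun i => by
    simp only [c]
    rw [taylor_zero, value_act, map_add, map_natCast, map_one, mul_one]
  obtain ⟨A, T, hT, hA⟩ := exists_norm_triangularSolution_le (c := c) (h := fun j => taylor j h)
    hh hB (fun j hj => by rw [hc0]; exact hlow j hj) hC hR hup hD (zero_le_one.trans hS) hhj
  set u := triangularSolution c fun j => taylor j h
  let g : Hol := ⟨PowerSeries.mk u,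
    (isHolomorphic_iff _).2 ⟨A, T, hT, fun n => by rw [PowerSeries.coeff_mk]; exact hA n⟩⟩
  have hg : ∀ j, taylor j g = u j := fun j => PowerSeries.coeff_mk j u
  refine ⟨g, fun j hj => (hg j).trans (triangularSolution_eq_zero hh j hj), taylor_ext fun j => ?_⟩
  rw [taylor_act]
  simp only [hg]
  exact sum_triangularSolution (c := c) hh (fun j hj => by rw [hc0]; exact hm j hj) j

theorem exists_mul_eq_one {a : Hol} (ha : value a ≠ 0) : ∃ g, a * g = 1 := by
  obtain ⟨g, -, hg⟩ := (isFuchsian_func ha).exists_act_eq 0 (m := 0) (h := 1)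
    (fun k _ => by rwa [eulerPart_func, Polynomial.eval_C]) (by simp)
  exact ⟨g, by rwa [act_func] at hg⟩

/-! ### Factorization into operators of first order -/

/-- The product of the first order operators `ε - b`, for `b` in the given list. -/
def linearProd (bs : List Hol) : Op := (bs.map fun b => eps - func b).prod

theorem linearProd_nil : linearProd [] = 1 := rfl

theorem linearProd_cons (b : Hol) (bs : List Hol) :
    linearProd (b :: bs) = (eps - func b) * linearProd bs := by
  rw [linearProd, List.map_cons, List.prod_cons, linearProd]

theorem linearProd_concat (bs : List Hol) (b : Hol) :
    linearProd (bs ++ [b]) = linearProd bs * (eps - func b) := by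
  rw [linearProd, List.map_append, List.prod_append, List.map_singleton, List.prod_singleton,
    linearProd]

theorem isFuchsian_one : IsFuchsian 1 := by
  rw [← map_one func]
  exact isFuchsian_func (by rw [map_one]; exact one_ne_zero)

theorem isFuchsian_linearProd (bs : List Hol) : IsFuchsian (linearProd bs) := by
  induction bs with
  | nil => exact isFuchsian_one
  | cons b bs ih =>
    rw [linearProd_cons]
    exact isFuchsian_mul_iff.2 ⟨isFuchsian_eps_sub_func b, ih⟩

theorem order_linearProd (bs : List Hol) : order (linearProd bs) = bs.length := by
  induction bs with
  | nil => rw [linearProd_nil, ← map_one func, order_func, List.length_nil]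
  | cons b bs ih =>
    rw [linearProd_cons, (isFuchsian_eps_sub_func b).order_mul (isFuchsian_linearProd bs),
      order_eps_sub_func, ih, List.length_cons, add_comm]

theorem eulerPart_linearProd (bs : List Hol) :
    eulerPart (linearProd bs) =
      ((bs.map value).map fun c => Polynomial.X - Polynomial.C c).prod := by
  induction bs with
  | nil => exact map_one eulerHom
  | cons b bs ih =>
    rw [linearProd_cons, eulerPart_mul, eulerPart_eps_sub_func, ih, List.map_cons, List.map_cons,
      List.prod_cons]

theorem roots_eulerPart_linearProd (bs : List Hol) :
    (eulerPart (linearProd bs)).roots = (bs.map value : List ℂ) := by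
  rw [eulerPart_linearProd, ← Multiset.prod_coe, ← Multiset.map_coe,
    Polynomial.roots_multiset_prod_X_sub_C]

/-- A nonconstant polynomial has a root `z` such that no `z + k`, `k ≥ 1`, is a root. -/
theorem exists_root_forall_add_natCast {p : Polynomial ℂ} (hp : p.natDegree ≠ 0) :
    ∃ z, p.IsRoot z ∧ ∀ k : ℕ, 1 ≤ k → p.eval (z + k) ≠ 0 := by
  have hp0 : p ≠ 0 := by
    rintro rfl
    exact hp Polynomial.natDegree_zero
  obtain ⟨x, hx⟩ := IsAlgClosed.exists_root p fun h =>
    hp (Polynomial.natDegree_eq_of_degree_eq_some h)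
  obtain ⟨z, hz, hmax⟩ := p.roots.toFinset.exists_max_image Complex.re
    ⟨x, by rwa [Multiset.mem_toFinset, Polynomial.mem_roots hp0]⟩
  rw [Multiset.mem_toFinset, Polynomial.mem_roots hp0] at hz
  refine ⟨z, hz, fun k hk h => ?_⟩
  have h1 := hmax (z + k) (by rwa [Multiset.mem_toFinset, Polynomial.mem_roots hp0])
  rw [Complex.add_re, Complex.natCast_re] at h1
  have h2 : (1 : ℝ) ≤ k := by exact_mod_cast hk
  linarith

/-- A Fuchsian operator of positive order has a right factor of first order, which annihilates a
solution `t^z y`, `y(0) = 1`, where `z` is a characteristic exponent of maximal real part. -/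
theorem IsFuchsian.exists_right_factor {L : Op} (hL : IsFuchsian L) (h0 : order L ≠ 0) :
    ∃ (Q : Op) (b : Hol), L = Q * (eps - func b) := by
  obtain ⟨z, hz, hmax⟩ := exists_root_forall_add_natCast
    (p := eulerPart L) (by rwa [hL.natDegree_eulerPart])
  set a := algebraMap ℂ Hol z
  have ha : value a = z := value_algebraMap z
  obtain ⟨w, hw, hLw⟩ := hL.exists_act_eq a (m := 1) (h := -act a L 1)
    (fun k hk => by rw [ha]; exact hmax k hk) (fun j hj => by
      rw [Nat.lt_one_iff.1 hj, taylor_zero, map_neg, value_act, ha, hz.eq_zero, zero_mul, neg_zero])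
  have hy : value (1 + w) = 1 := by
    rw [map_add, map_one, ← taylor_zero w, hw 0 one_pos, add_zero]
  obtain ⟨v, hv⟩ := exists_mul_eq_one (a := 1 + w) (by rw [hy]; exact one_ne_zero)
  have hy0 : 1 + w ≠ 0 := left_ne_zero_of_mul_eq_one hv
  obtain ⟨Q, hQ⟩ := exists_eq_mul_of_act_eq_zero (b := a) (c := a + euler (1 + w) * v) hy0
    (by linear_combination (-euler (1 + w)) * hv) (L := L)
    (by rw [LinearMap.map_add, hLw, add_neg_cancel])
  exact ⟨Q, _, hQ⟩

theorem IsFuchsian.exists_eq_func_mul_linearProd {L : Op} (hL : IsFuchsian L) :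
    ∃ (a : Hol) (bs : List Hol), value a ≠ 0 ∧ L = func a * linearProd bs := by
  induction hn : order L generalizing L with
  | zero =>
    obtain ⟨a, ha⟩ := Polynomial.natDegree_eq_zero.1 hn
    have hLa : L = func a := symbol_injective ha.symm
    refine ⟨a, [], ?_, by rw [linearProd_nil, mul_one, hLa]⟩
    rwa [IsFuchsian, ← ha, Polynomial.leadingCoeff_C] at hL
  | succ n ih =>
    obtain ⟨Q, b, rfl⟩ := hL.exists_right_factor (by omega)
    have hQ := (isFuchsian_mul_iff.1 hL).1
    rw [hQ.order_mul (isFuchsian_eps_sub_func b), order_eps_sub_func, Nat.add_right_cancel_iff]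
      at hn
    obtain ⟨a, bs, ha, rfl⟩ := ih hQ hn
    exact ⟨a, bs ++ [b], ha, by rw [linearProd_concat, mul_assoc]⟩

/-! ### The normal form -/

theorem factor_eq (c : ℂ) (r : Polynomial ℂ) :
    factor c r = eps - func (algebraMap ℂ Hol c - ofPoly r) := by
  rw [factor, map_sub]
  abel

theorem prod_factor (l : List (ℂ × Polynomial ℂ)) :
    (l.map fun p => factor p.1 p.2).prod =
      linearProd (l.map fun p => algebraMap ℂ Hol p.1 - ofPoly p.2) := by
  rw [linearProd, List.map_map]
  simp only [factor_eq, Function.comp_def]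

theorem order_add_le {L M : Op} {n : ℕ} (hL : order L ≤ n) (hM : order M ≤ n) :
    order (L + M) ≤ n := by
  rw [order, map_add]
  exact Polynomial.natDegree_add_le_of_degree_le hL hM

theorem order_func_mul_le (a : Hol) (L : Op) : order (func a * L) ≤ order L := by
  have h := (symbol_mul_top (L := func a) (M := L) (order_func a).le le_rfl).1
  rwa [zero_add] at h

/-- In the action with `ε` acting as `δ + b`, the germ `(ε - b(0)) f` vanishes at the origin. A
polynomial correction `r` makes `(ε - b(0) + r) f` vanish to order greater than `N`: it is the
truncation of the germ for which this is zero. -/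
theorem exists_polynomial_correction (N : ℕ) (b f : Hol) (hf : value f ≠ 0) :
    ∃ r : Polynomial ℂ, r.eval 0 = 0 ∧ r.natDegree ≤ N ∧
      ∀ j < N + 1, taylor j (act b (factor (value b) r) f) = 0 := by
  set s : Hol := (algebraMap ℂ Hol (value b) - b) * f - euler f with hs
  set q : ℂ⟦X⟧ := (s : ℂ⟦X⟧) * (f : ℂ⟦X⟧)⁻¹ with hq
  have hqf : q * (f : ℂ⟦X⟧) = s := by
    rw [hq, mul_assoc, PowerSeries.inv_mul_cancel _ hf, mul_one]
  have hs0 : PowerSeries.constantCoeff (s : ℂ⟦X⟧) = 0 := by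
    change value s = 0
    rw [hs, map_sub, map_mul, map_sub, value_algebraMap, value_euler, sub_self, zero_mul, sub_zero]
  refine ⟨PowerSeries.trunc (N + 1) q, ?_, ?_, fun j hj => ?_⟩
  · rw [← Polynomial.coeff_zero_eq_eval_zero, PowerSeries.coeff_trunc, if_pos N.succ_pos,
      PowerSeries.coeff_zero_eq_constantCoeff_apply, hq, map_mul, hs0, zero_mul]
  · exact Nat.lt_succ_iff.1 (PowerSeries.natDegree_trunc_lt q N)
  · have h1 : act b (factor (value b) (PowerSeries.trunc (N + 1) q)) f =
        ofPoly (PowerSeries.trunc (N + 1) q) * f - s := by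
      rw [factor_eq, act_eps_sub_func, hs]
      ring
    have h2 : taylor j s = ∑ p ∈ antidiagonal j, PowerSeries.coeff p.1 q * taylor p.2 f := by
      rw [taylor_apply, ← hqf, PowerSeries.coeff_mul]
      rfl
    rw [h1, map_sub, taylor_mul, h2, sub_eq_zero]
    refine Finset.sum_congr rfl fun p hp => ?_
    have hp' := mem_antidiagonal.1 hp
    congr 1
    change PowerSeries.coeff p.1 (PowerSeries.trunc (N + 1) q : ℂ⟦X⟧) = _
    rw [Polynomial.coeff_coe, PowerSeries.coeff_trunc, if_pos (by omega)]

/-- The inductive step of the normalization: an equivalence `M H = K P` extends to a left multiple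
`(ε - b) P` of `P`. -/
theorem exists_extension {N : ℕ} {b : Hol} {bs cs : List Hol} (hcs : cs.map value = bs.map value)
    (hN : ∀ c ∈ bs, ∀ k : ℕ, value c - value b = k → k ≤ N) {H K : Op} {n : ℕ}
    (hHK : linearProd cs * H = K * linearProd bs) (hH : order H ≤ n) (hbs : bs.length ≤ n)
    (hco : IsCoprime (eulerPart H) (eulerPart (linearProd bs))) :
    ∃ (r : Polynomial ℂ) (H' K' : Op), r.eval 0 = 0 ∧ r.natDegree ≤ N ∧
      factor (value b) r * linearProd cs * H' = K' * linearProd (b :: bs) ∧ order H' ≤ n ∧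
      IsCoprime (eulerPart H') (eulerPart (linearProd (b :: bs))) := by
  set P := linearProd bs with hP
  set M := linearProd cs with hM
  have hMP : eulerPart M = eulerPart P := by
    rw [hM, hP, eulerPart_linearProd, eulerPart_linearProd, hcs]
  have hP0 : eulerPart P ≠ 0 := (isFuchsian_linearProd bs).eulerPart_ne_zero
  -- A constant multiple of `P` is added to `H` to avoid a zero of its Euler part at `b(0)`.
  obtain ⟨a, ha⟩ : ∃ a : Hol,
      (eulerPart H).eval (value b) + value a * (eulerPart P).eval (value b) ≠ 0 := by
    by_cases h : (eulerPart H).eval (value b) = 0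
    · refine ⟨1, fun h1 => ?_⟩
      rw [h, map_one, one_mul, zero_add] at h1
      obtain ⟨u, v, huv⟩ := hco
      have h2 := congrArg (Polynomial.eval (value b)) huv
      rw [Polynomial.eval_add, Polynomial.eval_mul, Polynomial.eval_mul, h, h1, mul_zero, mul_zero,
        add_zero, Polynomial.eval_one] at h2
      exact zero_ne_one h2
    · exact ⟨0, by rwa [map_zero, zero_mul, add_zero]⟩
  obtain ⟨H₁, hH₁⟩ : ∃ H₁ : Op, H₁ = H + func a * P := ⟨_, rfl⟩
  obtain ⟨K₁, hK₁⟩ : ∃ K₁ : Op, K₁ = K + M * func a := ⟨_, rfl⟩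
  have hHK₁ : M * H₁ = K₁ * P := by
    rw [hH₁, hK₁, mul_add, add_mul, hHK, mul_assoc]
  have hEH₁ : eulerPart H₁ = eulerPart H + Polynomial.C (value a) * eulerPart P := by
    rw [hH₁, eulerPart_add, eulerPart_mul, eulerPart_func]
  have hEK₁ : eulerPart K₁ = eulerPart H₁ := by
    have h := congrArg eulerPart hHK₁
    rw [eulerPart_mul, eulerPart_mul, hMP, mul_comm] at h
    exact (mul_right_cancel₀ hP0 h).symm
  have hval : (eulerPart H₁).eval (value b) ≠ 0 := by
    rwa [hEH₁, Polynomial.eval_add, Polynomial.eval_mul, Polynomial.eval_C]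
  have hco₁ : IsCoprime (eulerPart H₁) (eulerPart P) := by
    rw [hEH₁]
    exact IsCoprime.add_mul_right_left hco _
  -- `f` is the obstruction to divisibility of `M * H₁` by `(ε - b) * P` on the right.
  set f := act b K₁ 1 with hf
  obtain ⟨r, hr0, hrN, hr⟩ := exists_polynomial_correction N b f (by
    rwa [hf, value_act, map_one, mul_one, hEK₁])
  have hfac : eulerPart (factor (value b) r) = Polynomial.X - Polynomial.C (value b) := by
    rw [factor_eq, eulerPart_eps_sub_func, map_sub, value_algebraMap, value_ofPoly, hr0, sub_zero]
  have hFuchs : IsFuchsian (factor (value b) r * M) := by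
    rw [factor_eq]
    exact isFuchsian_mul_iff.2 ⟨isFuchsian_eps_sub_func _, isFuchsian_linearProd cs⟩
  obtain ⟨g, hg, hgf⟩ := hFuchs.exists_act_eq b (m := N + 1)
    (h := -act b (factor (value b) r) f) (fun k hk => by
      rw [eulerPart_mul, hfac, Polynomial.eval_mul, hMP]
      refine mul_ne_zero ?_ fun h0 => ?_
      · rw [Polynomial.eval_sub, Polynomial.eval_X, Polynomial.eval_C, add_sub_cancel_left,
          Nat.cast_ne_zero]
        omega
      · have h1 := (Polynomial.mem_roots hP0).2 h0
        rw [hP, roots_eulerPart_linearProd, Multiset.mem_coe, List.mem_map] at h1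
        obtain ⟨c, hc, hck⟩ := h1
        have h2 := hN c hc k (by rw [hck, add_sub_cancel_left])
        omega)
    (fun j hj => by rw [map_neg, hr j hj, neg_zero])
  have hg0 : value g = 0 := by rw [← taylor_zero, hg 0 N.succ_pos]
  obtain ⟨K', hK'⟩ := exists_eq_mul_of_act_eq_zero (δ := euler) (b := b) (c := b) (y := 1)
    one_ne_zero (by rw [Derivation.map_one_eq_zero, zero_add])
    (L := factor (value b) r * (K₁ + M * func g)) (by
      rw [act_mul, act_add, act_mul b M, act_func, mul_one, LinearMap.map_add, ← hf,
        ← act_mul b _ M, hgf, add_neg_cancel])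
  refine ⟨r, H₁ + func g * P, K', hr0, hrN, ?_, ?_, ?_⟩
  · rw [linearProd_cons, ← mul_assoc, ← hK', mul_assoc, mul_assoc, mul_add, hHK₁, add_mul,
      mul_assoc M]
  · have hPn : order P ≤ n := by rwa [hP, order_linearProd]
    rw [hH₁]
    exact order_add_le (order_add_le hH ((order_func_mul_le _ _).trans hPn))
      ((order_func_mul_le _ _).trans hPn)
  · rw [eulerPart_add, eulerPart_mul, eulerPart_func, hg0, Polynomial.C_0, zero_mul, add_zero,
      linearProd_cons, eulerPart_mul, eulerPart_eps_sub_func]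
    refine IsCoprime.mul_right ?_ hco₁
    refine ((Polynomial.irreducible_X_sub_C (value b)).coprime_iff_not_dvd.2 ?_).symm
    rwa [Polynomial.dvd_iff_isRoot]

theorem exists_normal_form {N : ℕ} (bs : List Hol)
    (hN : ∀ b ∈ bs, ∀ c ∈ bs, ∀ k : ℕ, value c - value b = k → k ≤ N) :
    ∃ (l : List (ℂ × Polynomial ℂ)) (H K : Op), l.map Prod.fst = bs.map value ∧
      (∀ p ∈ l, p.2.eval 0 = 0 ∧ p.2.natDegree ≤ N) ∧
      (l.map fun p => factor p.1 p.2).prod * H = K * linearProd bs ∧ order H ≤ bs.length ∧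
      IsCoprime (eulerPart H) (eulerPart (linearProd bs)) := by
  induction bs with
  | nil =>
    refine ⟨[], 1, 1, rfl, by simp, rfl, ?_, ?_⟩
    · rw [← map_one func, order_func]
      exact Nat.zero_le _
    · rw [← eulerHom_apply 1, map_one]
      exact isCoprime_one_left
  | cons b bs ih =>
    obtain ⟨l, H, K, hl, hlN, hHK, hH, hco⟩ := ih fun c hc d hd =>
      hN c (List.mem_cons_of_mem b hc) d (List.mem_cons_of_mem b hd)
    rw [prod_factor] at hHK
    have hcs : (l.map fun p => algebraMap ℂ Hol p.1 - ofPoly p.2).map value = bs.map value := by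
      rw [← hl, List.map_map]
      refine List.map_congr_left fun p hp => ?_
      rw [Function.comp_apply, map_sub, value_algebraMap, value_ofPoly, (hlN p hp).1, sub_zero]
    obtain ⟨r, H', K', hr0, hrN, hHK', hH', hco'⟩ := exists_extension (N := N) (b := b)
      (n := bs.length + 1) hcs
      (fun c hc => hN b List.mem_cons_self c (List.mem_cons_of_mem b hc)) hHK
      (hH.trans (Nat.le_succ _)) (Nat.le_succ _) hco
    refine ⟨(value b, r) :: l, H', K', by rw [List.map_cons, List.map_cons, hl], ?_, ?_, hH', hco'⟩
    · rintro p hp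
      rcases List.mem_cons.1 hp with rfl | hp
      · exact ⟨hr0, hrN⟩
      · exact hlN p hp
    · rw [List.map_cons, List.prod_cons, prod_factor]
      exact hHK'

/-- In the definition of equivalence the operators `H`, `K` need not be assumed Fuchsian if the
order of `H` is at most that of `L`: a multiple of `L` added to `H` makes them so. -/
theorem FEquiv.of_order_le {L M H K : Op} (hL : IsFuchsian L) (hM : IsFuchsian M)
    (hLM : order L = order M) (hHK : M * H = K * L) (hH : order H ≤ order L)
    (hco : IsCoprime (eulerPart H) (eulerPart L)) : FEquiv L M := by
  obtain ⟨a, ha⟩ : ∃ a : Hol,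
      value ((symbol H).coeff (order L)) + value a * value (symbol L).leadingCoeff ≠ 0 := by
    by_cases h : value ((symbol H).coeff (order L)) = 0
    · exact ⟨1, by rw [h, map_one, one_mul, zero_add]; exact hL⟩
    · exact ⟨0, by rwa [map_zero, zero_mul, add_zero]⟩
  have hcoeff : value ((symbol (H + func a * L)).coeff (order L)) ≠ 0 := by
    have h1 := (symbol_mul_top (L := func a) (M := L) (order_func a).le le_rfl).2
    rw [zero_add] at h1
    have h2 : (symbol (func a : Op)).coeff 0 = a := Polynomial.coeff_C_zero
    rw [map_add, Polynomial.coeff_add, map_add, order, h1, h2, map_mul]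
    exact ha
  have hH' : IsFuchsian (H + func a * L) := by
    have hd : (symbol (H + func a * L)).natDegree = order L :=
      Polynomial.natDegree_eq_of_le_of_coeff_ne_zero
        (order_add_le hH (order_func_mul_le a L)) fun h0 => hcoeff (by rw [h0, map_zero])
    rw [IsFuchsian, Polynomial.leadingCoeff, hd]
    exact hcoeff
  have hHK' : M * (H + func a * L) = (K + M * func a) * L := by
    rw [mul_add, add_mul, hHK, mul_assoc]
  refine ⟨hLM, H + func a * L, K + M * func a, hH', ?_, hHK', ?_⟩
  · have h := isFuchsian_mul_iff.2 ⟨hM, hH'⟩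
    rw [hHK'] at h
    exact (isFuchsian_mul_iff.1 h).1
  · rw [eulerPart_add, eulerPart_mul, eulerPart_func]
    exact IsCoprime.add_mul_right_left hco _

end Fuchs

end

open Fuchs Fuchs.DiffOp in
theorem proposition4 (L : Fuchs.Op) (hL : Fuchs.IsFuchsian L) :
    ∃ (lam : Fin (Fuchs.DiffOp.order L) → ℂ)
      (r : Fin (Fuchs.DiffOp.order L) → Polynomial ℂ) (M : Fuchs.Op),
      M = (List.ofFn fun i => Fuchs.factor (lam i) (r i)).prod ∧
      (Fuchs.eulerPart L).roots = Finset.univ.val.map lam ∧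
      (∀ i, (r i).eval 0 = 0 ∧
        (r i).natDegree ≤ Fuchs.maxResonance (Fuchs.eulerPart L)) ∧
      Fuchs.IsFuchsian M ∧ Fuchs.FEquiv L M := by
  obtain ⟨a, bs, ha, hLa⟩ := hL.exists_eq_func_mul_linearProd
  have hE : eulerPart L = Polynomial.C (value a) * eulerPart (linearProd bs) := by
    rw [hLa, eulerPart_mul, eulerPart_func]
  have hroots : (eulerPart L).roots = (bs.map value : List ℂ) := by
    rw [hE, Polynomial.roots_C_mul _ ha, roots_eulerPart_linearProd]
  have hmem : ∀ b ∈ bs, (eulerPart L).IsRoot (value b) := fun b hb => by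
    rw [← Polynomial.mem_roots hL.eulerPart_ne_zero, hroots, Multiset.mem_coe]
    exact List.mem_map_of_mem hb
  obtain ⟨l, H, K, hl, hlN, hHK, hH, hco⟩ := exists_normal_form
    (N := maxResonance (eulerPart L)) bs fun b hb c hc k hk =>
      le_csSup (rootDifferences_finite hL.eulerPart_ne_zero).bddAbove
        ⟨_, _, hmem b hb, hmem c hc, hk⟩
  have hord : order L = bs.length := by
    rw [hLa, (isFuchsian_func ha).order_mul (isFuchsian_linearProd bs), order_func,
      order_linearProd, zero_add]
  have hlen : l.length = bs.length := by
    rw [← List.length_map (f := Prod.fst), hl, List.length_map]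
  obtain ⟨v, hv⟩ := exists_mul_eq_one ha
  have hM : IsFuchsian (l.map fun p => factor p.1 p.2).prod := by
    rw [prod_factor]
    exact isFuchsian_linearProd _
  have hMord : order L = order (l.map fun p => factor p.1 p.2).prod := by
    rw [prod_factor, order_linearProd, List.length_map, hord, hlen]
  have hequiv : FEquiv L (l.map fun p => factor p.1 p.2).prod := by
    refine FEquiv.of_order_le (H := H) (K := K * func v) hL hM hMord ?_ (hH.trans_eq hord.symm) ?_
    · rw [hHK, hLa, mul_assoc, ← mul_assoc (func v), ← map_mul, mul_comm v, hv, map_one, one_mul]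
    · rw [hE]
      exact (isCoprime_mul_unit_left_right (Polynomial.isUnit_C.2 ha.isUnit) _ _).2 hco
  obtain ⟨p, rfl⟩ : ∃ p : Fin (order L) → ℂ × Polynomial ℂ, l = List.ofFn p := by
    rw [hord, ← hlen]
    exact ⟨l.get, (List.ofFn_get l).symm⟩
  refine ⟨fun i => (p i).1, fun i => (p i).2, _, ?_, ?_,
    fun i => hlN (p i) (List.mem_ofFn.2 ⟨i, rfl⟩), hM, hequiv⟩
  · rw [List.map_ofFn]
    rfl
  · rw [hroots, Fin.univ_val_map, ← hl, List.map_ofFn]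
    rfl
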